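/- All ordered vector spaces are real and partially ordered by a cone; linear subspaces carry the induced order. An ordered vector space $X$ is *Archimedean* if $nx\le y$ for all $n\in\mathbb N$ implies $x\le 0$. A subspace $D\subseteq Y$ of an ordered vector space $Y$ is *order dense* in $Y$ if $y=\inf\{d\in D: y\le d\}$ (infimum in $Y$) for every $y\in Y$. A linear map $i\colon X\to Y$ is *bipositive* if $i(x)\ge 0\iff x\ge 0$. A *vector lattice cover* of $X$ is a pair $(Y,i)$ of a vector lattice $Y$ and a bipositive linear map $i\colon X\to Y$ such that $i(X)$ is order dense in $Y$; $X$ is a *pre-Riesz space* if it has a vector lattice cover. The *Dedekind completion* $(X^\delta,i)$ of $X$ is the (up to isomorphism unique) vector lattice cover that is Dedekind complete, i.e. in which every non-empty subset that is bounded above has a supremum. A pre-Riesz space $X$ is *pervasive* if for some, equivalently every, vector lattice cover $(Y,i)$ of $X$ and every $y\in Y$ with $y>0$ there is $x\in X$ with $0<i(x)\le y$. A linear subspace $I\subseteq X$ is an *ideal* if for all $x\in X$, $y\in I$ such that every upper bound of $\{y,-y\}$ in $X$ is an upper bound of $\{x,-x\}$ one has $x\in I$; it is *directed* if any two elements of $I$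 have an upper bound in $I$. An *extension ideal* of an ideal $I$ of $X$ in a vector lattice cover $(Y,i)$ is an ideal $J$ of $Y$ with $\{x\in X: i(x)\in J\}=I$. **Corollary.** Let $X$ be an Archimedean pervasive pre-Riesz space with Dedekind completion $(X^\delta,i)$, and let $I\subseteq X$ be a directed ideal. Then the intersection $\hat I$ of all extension ideals of $I$ in $X^\delta$ is itself an extension ideal of $I$, hence the smallest one; $(\hat I,i|_I)$ is the Dedekind completion of $I$; and $I$ is a pervasive pre-Riesz space. -/

import Mathlib

/-!
Ordered real vector spaces are types `X` with
`[AddCommGroup X] [Module ℝ X] [PartialOrder X] [IsOrderedAddMonoid X] [PosSMulMono ℝ X]`: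
the order is translation invariant and invariant under multiplication by nonnegative reals, so
that `{x | 0 ≤ x}` is a cone.  Linear subspaces `Submodule ℝ X` carry the induced order.
Being a vector lattice is a property of the order.
-/

namespace OrderedVectorSpace

universe u v w

section Order

variable (X : Type u) [AddCommGroup X] [Module ℝ X] [PartialOrder X] [IsOrderedAddMonoid X]
  [PosSMulMono ℝ X]

/-- `X` is Archimedean: if `n x ≤ y` for all natural numbers `n`, then `x ≤ 0`. (Mathlib's
`Archimedean` is a different notion, meant for linear orders.) -/
def IsArchimedean : Prop :=
  ∀ x y : X, (∀ n : ℕ, n • x ≤ y) → x ≤ 0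

/-- The ordered vector space `X` is a vector lattice: any two elements have a supremum and an
infimum. -/
def IsVectorLattice : Prop :=
  ∀ a b : X, (∃ s, IsLUB {a, b} s) ∧ (∃ t, IsGLB {a, b} t)

/-- Every nonempty subset of `X` that is bounded above has a supremum. -/
def IsDedekindComplete : Prop :=
  ∀ S : Set X, S.Nonempty → BddAbove S → ∃ s, IsLUB S s

variable {X}

/-- The subspace `D` is directed: any two elements of `D` have an upper bound in `D`. -/
def IsDirectedSubspace (D : Submodule ℝ X) : Prop :=
  ∀ x ∈ D, ∀ y ∈ D, ∃ z ∈ D, x ≤ z ∧ y ≤ z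

/-- The subspace `D` is order dense in `X`: every `x` is the infimum in `X` of the set of all
elements of `D` above `x`. -/
def IsOrderDense (D : Submodule ℝ X) : Prop :=
  ∀ x : X, IsGLB {z | z ∈ D ∧ x ≤ z} x

/-- The subspace `I` is an ideal, that is, a solid subspace: if `y ∈ I` and every upper bound of
`{y, -y}` is an upper bound of `{x, -x}`, then `x ∈ I`. -/
def IsIdeal (I : Submodule ℝ X) : Prop :=
  ∀ x : X, ∀ y ∈ I, upperBounds {y, -y} ⊆ upperBounds {x, -x} → x ∈ I

end Order

section Maps

variable {X : Type u} [AddCommGroup X] [Module ℝ X] [PartialOrder X] [IsOrderedAddMonoid X]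
  [PosSMulMono ℝ X]
variable {Y : Type v} [AddCommGroup Y] [Module ℝ Y] [PartialOrder Y] [IsOrderedAddMonoid Y]
  [PosSMulMono ℝ Y]

/-- A bipositive linear map (an embedding of ordered vector spaces). -/
def IsBipositive (i : X →ₗ[ℝ] Y) : Prop :=
  ∀ x : X, 0 ≤ i x ↔ 0 ≤ x

/-- `(Y, i)` is a vector lattice cover of `X`: `Y` is a vector lattice and `i : X → Y` is a
bipositive linear map whose range is order dense in `Y`. -/
structure IsVectorLatticeCover (i : X →ₗ[ℝ] Y) : Prop where
  isVectorLattice : IsVectorLattice Y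
  isBipositive : IsBipositive i
  isOrderDense : IsOrderDense (LinearMap.range i)

/-- `(Y, i)` is the Dedekind completion of `X` (which is unique up to isomorphism): a vector
lattice cover of `X` that is Dedekind complete. -/
structure IsDedekindCompletion (i : X →ₗ[ℝ] Y) : Prop extends IsVectorLatticeCover i where
  isDedekindComplete : IsDedekindComplete Y

/-- `X` is pervasive in `Y` (with respect to `i`): below every `y > 0` in `Y` there is some
`i x` with `0 < i x`. -/
def IsPervasiveIn (i : X →ₗ[ℝ] Y) : Prop :=
  ∀ y : Y, 0 < y → ∃ x : X, 0 < i x ∧ i x ≤ y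

/-- The ideal `J` in `Y` is an extension ideal of `I`: the preimage of `J` under `i` is `I`. -/
def IsExtensionIdeal (i : X →ₗ[ℝ] Y) (I : Submodule ℝ X) (J : Submodule ℝ Y) : Prop :=
  IsIdeal J ∧ J.comap i = I

/-- The intersection of all extension ideals of `I` in `Y`. If `I` has an extension ideal, this is
the smallest one. -/
def smallestExtensionIdeal (i : X →ₗ[ℝ] Y) (I : Submodule ℝ X) : Submodule ℝ Y :=
  sInf {J | IsExtensionIdeal i I J}

theorem map_mem_smallestExtensionIdeal (i : X →ₗ[ℝ] Y) (I : Submodule ℝ X) :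
    ∀ x ∈ I, i x ∈ smallestExtensionIdeal i I := by
  intro x hx
  refine (Submodule.mem_sInf).2 fun J hJ => ?_
  have h : x ∈ J.comap i := by rw [hJ.2]; exact hx
  exact h

/-- The restriction of `i` to a map from `I` to the smallest extension ideal of `I`. -/
def restrictToExtension (i : X →ₗ[ℝ] Y) (I : Submodule ℝ X) :
    I →ₗ[ℝ] smallestExtensionIdeal i I :=
  i.restrict (map_mem_smallestExtensionIdeal i I)

theorem IsBipositive.le_iff {i : X →ₗ[ℝ] Y} (hi : IsBipositive i) {a b : X} :
    i a ≤ i b ↔ a ≤ b := by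
  rw [← sub_nonneg, ← map_sub, hi, sub_nonneg]

/-- Pervasiveness does not depend on the choice of the vector lattice cover. -/
theorem IsPervasiveIn.of_cover
    {Z : Type w} [AddCommGroup Z] [Module ℝ Z] [PartialOrder Z] [IsOrderedAddMonoid Z]
    [PosSMulMono ℝ Z] {i : X →ₗ[ℝ] Y} {j : X →ₗ[ℝ] Z} (hi : IsVectorLatticeCover i)
    (hj : IsVectorLatticeCover j) (h : IsPervasiveIn i) : IsPervasiveIn j := by
  intro z hz
  have h1 : ∃ b : X, -z ≤ j b ∧ ¬ 0 ≤ b := by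
    by_contra hcon
    push Not at hcon
    have h0 : (0 : Z) ≤ -z := by
      refine (hj.isOrderDense (-z)).2 ?_
      rintro _ ⟨⟨b, rfl⟩, hb⟩
      exact (hj.isBipositive b).2 (hcon b hb)
    exact absurd (neg_nonneg.1 h0) (not_le_of_gt hz)
  obtain ⟨b, hb, hb0⟩ := h1
  obtain ⟨s, hs⟩ := (hi.isVectorLattice (i (-b)) 0).1
  have hs0 : 0 ≤ s := hs.1 (by simp)
  have hsb : i (-b) ≤ s := hs.1 (by simp)
  have hs1 : 0 < s := by
    refine lt_of_le_of_ne hs0 fun he => hb0 ?_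
    rw [← he, map_neg, neg_nonpos] at hsb
    exact (hi.isBipositive b).1 hsb
  obtain ⟨x, hx0, hxs⟩ := h s hs1
  refine ⟨x, lt_of_le_of_ne ((hj.isBipositive x).2 ((hi.isBipositive x).1 hx0.le)) ?_, ?_⟩
  · intro he
    have hx : x ≤ 0 := by
      rw [← hj.isBipositive.le_iff, map_zero, ← he]
    have : i x ≤ 0 := by simpa using (hi.isBipositive.le_iff (a := x) (b := 0)).2 hx
    exact absurd this (not_le_of_gt hx0)
  · refine (hj.isOrderDense z).2 ?_
    rintro _ ⟨⟨c, rfl⟩, hc⟩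
    rw [hj.isBipositive.le_iff, ← hi.isBipositive.le_iff]
    refine hxs.trans (hs.2 ?_)
    rintro y (rfl | rfl)
    · rw [hi.isBipositive.le_iff, ← hj.isBipositive.le_iff, map_neg]
      exact (neg_le.1 hb).trans hc
    · exact (hi.isBipositive c).2 ((hj.isBipositive c).1 (hz.le.trans hc))

end Maps

section PreRiesz

variable (X : Type u) [AddCommGroup X] [Module ℝ X] [PartialOrder X] [IsOrderedAddMonoid X]
  [PosSMulMono ℝ X]

/-- `X` is a pre-Riesz space: it has a vector lattice cover. (The universe of `Y` is no
restriction, since a vector lattice cover injects into the power set of `X`.) -/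
def IsPreRiesz : Prop :=
  ∃ (Y : Type u) (_ : AddCommGroup Y) (_ : Module ℝ Y) (_ : PartialOrder Y)
    (_ : IsOrderedAddMonoid Y) (_ : PosSMulMono ℝ Y) (i : X →ₗ[ℝ] Y), IsVectorLatticeCover i

/-- The pre-Riesz space `X` is pervasive: it is pervasive in its vector lattice covers. By
`IsPervasiveIn.of_cover` it is the same to ask this for one or for all of them. -/
def IsPervasive : Prop :=
  IsPreRiesz X ∧
    ∀ (Y : Type u) [AddCommGroup Y] [Module ℝ Y] [PartialOrder Y] [IsOrderedAddMonoid Y]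
      [PosSMulMono ℝ Y] (i : X →ₗ[ℝ] Y), IsVectorLatticeCover i → IsPervasiveIn i

end PreRiesz

end OrderedVectorSpace

namespace OrderedVectorSpace

universe u

section IdealExtension

variable {X : Type*} [AddCommGroup X] [Module ℝ X] [PartialOrder X] [IsOrderedAddMonoid X]
  [PosSMulMono ℝ X]
variable {Y : Type*} [AddCommGroup Y] [Module ℝ Y] [PartialOrder Y] [IsOrderedAddMonoid Y]
  [PosSMulMono ℝ Y]
variable {i : X →ₗ[ℝ] Y} {I : Submodule ℝ X}

/-! As `I` is directed, the order intervals `[-i z, i z]` with `z ∈ I` have a subspace as union,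
`idealSpan`. It lies in every extension ideal and, `I` being solid, pulls back to `I`; so it is the
intersection. It is order convex, hence inherits suprema and infima from `Y`.

The real point is order density of `i(I)`, which rests on `isLUB_nonneg_le`: in the Archimedean
pervasive case, a positive element of the cover is the supremum of the positive elements of `i(X)`
below it. For `y ≤ i e` this is applied to `i e - y`; the elements found come from `I` by solidity,
and subtracting them from `i e` approximates `y` from above. -/

instance posSMulMono_submodule (J : Submodule ℝ X) : PosSMulMono ℝ J where
  smul_le_smul_of_nonneg_left c hc a b h := by
    change c • (a : X) ≤ c • (b : X)
    exact smul_le_smul_of_nonneg_left h hc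

/-- A directed subspace contains, with any element `x`, an upper bound of `{x, -x}`. -/
theorem IsDirectedSubspace.exists_abs_le (hDir : IsDirectedSubspace I) {x : X} (hx : x ∈ I) :
    ∃ z ∈ I, -z ≤ x ∧ x ≤ z := by
  obtain ⟨z, hz, h1, h2⟩ := hDir x hx (-x) (I.neg_mem hx)
  exact ⟨z, hz, neg_le.1 h2, h1⟩

/-- An ideal contains every element lying between `-z` and `z` for some `z` in the ideal. -/
theorem IsIdeal.mem_of_abs_le (hI : IsIdeal I) {x z : X} (hz : z ∈ I) (h1 : -z ≤ x)
    (h2 : x ≤ z) : x ∈ I := by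
  refine hI x z hz fun u hu => ?_
  have hzu : z ≤ u := hu (by simp)
  rintro y (rfl | rfl)
  · exact h2.trans hzu
  · exact (neg_le.1 h1).trans hzu

/-- The ideal of the codomain generated by the image of a directed subspace. -/
def idealSpan (i : X →ₗ[ℝ] Y) (I : Submodule ℝ X) : Submodule ℝ Y where
  carrier := {y | ∃ z ∈ I, -i z ≤ y ∧ y ≤ i z}
  zero_mem' := ⟨0, I.zero_mem, by simp, by simp⟩
  add_mem' := by
    rintro a b ⟨z, hz, h1, h2⟩ ⟨t, ht, h3, h4⟩
    refine ⟨z + t, I.add_mem hz ht, ?_, ?_⟩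
    · rw [map_add, neg_add]
      exact add_le_add h1 h3
    · rw [map_add]
      exact add_le_add h2 h4
  smul_mem' := by
    rintro c y ⟨z, hz, h1, h2⟩
    rcases le_total 0 c with hc | hc
    · refine ⟨c • z, I.smul_mem c hz, ?_, ?_⟩
      · rw [map_smul, ← smul_neg]
        exact smul_le_smul_of_nonneg_left h1 hc
      · rw [map_smul]
        exact smul_le_smul_of_nonneg_left h2 hc
    · have hc' : 0 ≤ -c := neg_nonneg.2 hc
      refine ⟨(-c) • z, I.smul_mem _ hz, ?_, ?_⟩
      · have := smul_le_smul_of_nonneg_left h2 hc'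
        rw [map_smul]
        rw [neg_smul c y] at this
        exact neg_le.1 (by simpa using this)
      · have := smul_le_smul_of_nonneg_left (neg_le.1 h1) hc'
        rw [map_smul]
        rwa [smul_neg, neg_smul c y, neg_neg] at this

theorem mem_idealSpan {y : Y} : y ∈ idealSpan i I ↔ ∃ z ∈ I, -i z ≤ y ∧ y ≤ i z :=
  Iff.rfl

/-- Solidity of `I` keeps the preimage inside `I`; directedness puts all of `I` into it. -/
theorem isExtensionIdeal_idealSpan (hi : IsBipositive i) (hI : IsIdeal I)
    (hDir : IsDirectedSubspace I) : IsExtensionIdeal i I (idealSpan i I) := by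
  refine ⟨fun x y hy h => ?_, le_antisymm ?_ ?_⟩
  · obtain ⟨z, hz, h1, h2⟩ := hy
    have hzu : i z ∈ upperBounds {x, -x} := by
      refine h ?_
      rintro w (rfl | rfl)
      · exact h2
      · exact neg_le.1 h1
    exact ⟨z, hz, neg_le.1 (hzu (by simp)), hzu (by simp)⟩
  · rintro x ⟨z, hz, h1, h2⟩
    rw [← map_neg, hi.le_iff] at h1
    exact hI.mem_of_abs_le hz h1 (hi.le_iff.1 h2)
  · intro x hx
    obtain ⟨z, hz, h1, h2⟩ := hDir.exists_abs_le hx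
    refine ⟨z, hz, ?_, hi.le_iff.2 h2⟩
    rw [← map_neg]
    exact hi.le_iff.2 h1

theorem idealSpan_le {J : Submodule ℝ Y} (hJ : IsExtensionIdeal i I J) : idealSpan i I ≤ J := by
  rintro y ⟨z, hz, h1, h2⟩
  have hzJ : i z ∈ J := by
    have : z ∈ J.comap i := by rw [hJ.2]; exact hz
    exact this
  exact hJ.1.mem_of_abs_le hzJ h1 h2

theorem isLeast_idealSpan (hi : IsBipositive i) (hI : IsIdeal I) (hDir : IsDirectedSubspace I) :
    IsLeast {J | IsExtensionIdeal i I J} (idealSpan i I) :=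
  ⟨isExtensionIdeal_idealSpan hi hI hDir, fun _ hJ => idealSpan_le hJ⟩

theorem smallestExtensionIdeal_eq_idealSpan (hi : IsBipositive i) (hI : IsIdeal I)
    (hDir : IsDirectedSubspace I) : smallestExtensionIdeal i I = idealSpan i I :=
  (isLeast_idealSpan hi hI hDir).csInf_eq

theorem mem_smallestExtensionIdeal (hi : IsBipositive i) (hI : IsIdeal I)
    (hDir : IsDirectedSubspace I) {y : Y} :
    y ∈ smallestExtensionIdeal i I ↔ ∃ z ∈ I, -i z ≤ y ∧ y ≤ i z := by
  rw [smallestExtensionIdeal_eq_idealSpan hi hI hDir, mem_idealSpan]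

/-- The smallest extension ideal is order convex. -/
theorem mem_smallestExtensionIdeal_of_le_of_le (hi : IsBipositive i) (hI : IsIdeal I)
    (hDir : IsDirectedSubspace I) {a b y : Y} (ha : a ∈ smallestExtensionIdeal i I)
    (hb : b ∈ smallestExtensionIdeal i I) (hay : a ≤ y) (hyb : y ≤ b) :
    y ∈ smallestExtensionIdeal i I := by
  rw [mem_smallestExtensionIdeal hi hI hDir] at *
  obtain ⟨s, hs, h1, -⟩ := ha
  obtain ⟨t, ht, -, h2⟩ := hb
  obtain ⟨z, hz, hsz, htz⟩ := hDir s hs t ht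
  exact ⟨z, hz, (neg_le_neg (hi.le_iff.2 hsz)).trans (h1.trans hay),
    (hyb.trans h2).trans (hi.le_iff.2 htz)⟩

theorem IsVectorLatticeCover.isPreRiesz {E F : Type u} [AddCommGroup E] [Module ℝ E]
    [PartialOrder E] [IsOrderedAddMonoid E] [PosSMulMono ℝ E] [AddCommGroup F] [Module ℝ F]
    [PartialOrder F] [IsOrderedAddMonoid F] [PosSMulMono ℝ F] {j : E →ₗ[ℝ] F}
    (hj : IsVectorLatticeCover j) : IsPreRiesz E :=
  ⟨F, _, _, _, inferInstance, inferInstance, j, hj⟩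

/-- Otherwise `y` would be the infimum of the empty set, hence the greatest element of `Y`. -/
theorem IsVectorLatticeCover.exists_le (hi : IsVectorLatticeCover i) {x : X} (hx : 0 < i x)
    (y : Y) : ∃ b : X, y ≤ i b := by
  by_contra! hcon
  have h : y + i x ≤ y := by
    refine (hi.isOrderDense y).2 ?_
    rintro _ ⟨⟨b, rfl⟩, hb⟩
    exact absurd hb (hcon b)
  exact absurd (add_le_iff_nonpos_right y |>.1 h) hx.not_ge

/-- In an Archimedean pervasive pre-Riesz space every positive element of a vector lattice cover
is the supremum of the positive elements below it. -/
theorem isLUB_nonneg_le (hArch : IsArchimedean X) (hi : IsVectorLatticeCover i)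
    (hp : IsPervasiveIn i) {y : Y} (hy : 0 ≤ y) : IsLUB {w | ∃ x, i x = w ∧ 0 ≤ w ∧ w ≤ y} y := by
  refine ⟨fun w ⟨_, _, _, h⟩ => h, fun u hu => ?_⟩
  obtain ⟨t, ht⟩ := (hi.isVectorLattice u y).2
  have htu : t ≤ u := ht.1 (by simp)
  have hty : t ≤ y := ht.1 (by simp)
  have hub : ∀ x : X, 0 ≤ i x → i x ≤ y → i x ≤ t := by
    intro x h0 h1
    refine ht.2 ?_
    rintro w (rfl | rfl)
    · exact hu ⟨x, rfl, h0, h1⟩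
    · exact h1
  rcases hty.eq_or_lt with h | h
  · rwa [← h]
  exfalso
  obtain ⟨x, hx0, hx⟩ := hp (y - t) (sub_pos.2 h)
  -- If `i (n • x) ≤ t`, adding `i x ≤ y - t` keeps the next multiple below `y`, hence below `u` and
  -- so below the infimum `t`.
  have hmul : ∀ n : ℕ, i (n • x) ≤ t := by
    intro n
    induction n with
    | zero => exact hub _ (by simp) (by simpa using hy)
    | succ n ih =>
      refine hub _ ?_ ?_
      · rw [map_nsmul]
        exact nsmul_nonneg hx0.le _
      · rw [succ_nsmul, map_add]
        simpa using add_le_add ih hx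
  obtain ⟨b, hb⟩ := hi.exists_le hx0 t
  have hxn : x ≤ 0 :=
    hArch x b fun n => hi.isBipositive.le_iff.1 ((hmul n).trans hb)
  have := (hi.isBipositive.le_iff (a := x) (b := 0)).2 hxn
  rw [map_zero] at this
  exact hx0.not_ge this

theorem isVectorLatticeCover_restrictToExtension (hArch : IsArchimedean X)
    (hi : IsVectorLatticeCover i) (hp : IsPervasiveIn i) (hI : IsIdeal I)
    (hDir : IsDirectedSubspace I) : IsVectorLatticeCover (restrictToExtension i I) := by
  have hb := hi.isBipositive
  refine ⟨fun a b => ⟨?_, ?_⟩, fun x => hb x, ?_⟩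
  · obtain ⟨s, hs⟩ := (hi.isVectorLattice a b).1
    obtain ⟨p, hp, -, hap⟩ := (mem_smallestExtensionIdeal hb hI hDir).1 a.2
    obtain ⟨q, hq, -, hbq⟩ := (mem_smallestExtensionIdeal hb hI hDir).1 b.2
    obtain ⟨r, hr, hpr, hqr⟩ := hDir p hp q hq
    have hsr : s ≤ i r := by
      refine hs.2 ?_
      rintro w (rfl | rfl)
      · exact hap.trans (hb.le_iff.2 hpr)
      · exact hbq.trans (hb.le_iff.2 hqr)
    refine ⟨⟨s, mem_smallestExtensionIdeal_of_le_of_le hb hI hDir a.2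
      (map_mem_smallestExtensionIdeal i I r hr) (hs.1 (by simp)) hsr⟩, ?_, ?_⟩
    · rintro w (rfl | rfl)
      · exact hs.1 (by simp)
      · exact hs.1 (by simp)
    · intro w hw
      refine hs.2 ?_
      rintro v (rfl | rfl)
      · exact hw (Set.mem_insert a {b})
      · exact hw (Set.mem_insert_of_mem a rfl)
  · obtain ⟨s, hs⟩ := (hi.isVectorLattice a b).2
    obtain ⟨p, hp, hap, -⟩ := (mem_smallestExtensionIdeal hb hI hDir).1 a.2
    obtain ⟨q, hq, hbq, -⟩ := (mem_smallestExtensionIdeal hb hI hDir).1 b.2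
    obtain ⟨r, hr, hpr, hqr⟩ := hDir p hp q hq
    have hsr : -i r ≤ s := by
      refine hs.2 ?_
      rintro w (rfl | rfl)
      · exact (neg_le_neg (hb.le_iff.2 hpr)).trans hap
      · exact (neg_le_neg (hb.le_iff.2 hqr)).trans hbq
    refine ⟨⟨s, mem_smallestExtensionIdeal_of_le_of_le hb hI hDir
      (Submodule.neg_mem _ (map_mem_smallestExtensionIdeal i I r hr)) a.2 hsr
      (hs.1 (by simp))⟩, ?_, ?_⟩
    · rintro w (rfl | rfl)
      · exact hs.1 (by simp)
      · exact hs.1 (by simp)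
    · intro w hw
      refine hs.2 ?_
      rintro v (rfl | rfl)
      · exact hw (Set.mem_insert a {b})
      · exact hw (Set.mem_insert_of_mem a rfl)
  · intro y
    refine ⟨fun z hz => hz.2, fun w hw => ?_⟩
    obtain ⟨e, he, hye, hey⟩ := (mem_smallestExtensionIdeal hb hI hDir).1 y.2
    have key : i e - y ≤ i e - w := by
      -- Reflection in `i e` turns approximation from below into approximation from above.
      refine (isLUB_nonneg_le hArch hi hp (sub_nonneg.2 hey)).2 ?_
      rintro _ ⟨x, rfl, hx0, hx⟩
      have hxI : x ∈ I := by
        -- Since `-i e ≤ y`, one has `i x ≤ i e - y ≤ i (e + e)`.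
        refine hI.mem_of_abs_le (z := e + e) (I.add_mem he he) ?_ ?_
        · have hxe : i 0 ≤ i (e + e) := by
            rw [map_zero, map_add, ← sub_neg_eq_add]
            exact hx0.trans (hx.trans (sub_le_sub_left hye _))
          exact (neg_nonpos.2 (hb.le_iff.1 hxe)).trans ((hb x).1 hx0)
        · rw [← hb.le_iff, map_add, ← sub_neg_eq_add]
          exact hx.trans (sub_le_sub_left hye _)
      have hle : w ≤ restrictToExtension i I ⟨e - x, I.sub_mem he hxI⟩ := by
        refine hw ⟨⟨_, rfl⟩, ?_⟩
        change (y : Y) ≤ i (e - x)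
        rw [map_sub]
        exact le_sub_comm.1 hx
      replace hle : (w : Y) ≤ i (e - x) := hle
      rw [map_sub] at hle
      exact le_sub_comm.1 hle
    have hwy : (w : Y) ≤ y := (sub_le_sub_iff_left (i e)).1 key
    exact hwy

/-- The supremum in `Y` lies between a member of `S` and an upper bound of `S`, so convexity
applies. -/
theorem isDedekindComplete_smallestExtensionIdeal (hi : IsBipositive i)
    (hY : IsDedekindComplete Y) (hI : IsIdeal I) (hDir : IsDirectedSubspace I) :
    IsDedekindComplete (smallestExtensionIdeal i I) := by
  rintro S ⟨a, ha⟩ ⟨b, hb⟩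
  have hub : (b : Y) ∈ upperBounds (Subtype.val '' S) := by
    rintro _ ⟨c, hc, rfl⟩
    exact hb hc
  obtain ⟨s, hs⟩ := hY (Subtype.val '' S) ⟨a, a, ha, rfl⟩ ⟨b, hub⟩
  refine ⟨⟨s, mem_smallestExtensionIdeal_of_le_of_le hi hI hDir a.2 b.2 (hs.1 ⟨a, ha, rfl⟩)
    (hs.2 hub)⟩, fun c hc => hs.1 ⟨c, hc, rfl⟩, fun w hw => hs.2 ?_⟩
  rintro _ ⟨c, hc, rfl⟩
  exact hw hc

theorem isPervasiveIn_restrictToExtension (hi : IsBipositive i) (hp : IsPervasiveIn i)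
    (hI : IsIdeal I) (hDir : IsDirectedSubspace I) :
    IsPervasiveIn (restrictToExtension i I) := by
  intro y hy
  obtain ⟨e, he, -, hye⟩ := (mem_smallestExtensionIdeal hi hI hDir).1 y.2
  obtain ⟨x, hx0, hx⟩ := hp y hy
  have hx0' : 0 ≤ x := (hi x).1 hx0.le
  have hxe : x ≤ e := hi.le_iff.1 (hx.trans hye)
  have hxI : x ∈ I := hI.mem_of_abs_le he ((neg_nonpos.2 (hx0'.trans hxe)).trans hx0') hxe
  exact ⟨⟨x, hxI⟩, hx0, hx⟩

end IdealExtension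

end OrderedVectorSpace

open OrderedVectorSpace in
theorem corollary4p5
    {X : Type*} [AddCommGroup X] [Module ℝ X] [PartialOrder X] [IsOrderedAddMonoid X]
    [PosSMulMono ℝ X]
    (hArch : IsArchimedean X) (hPre : IsPreRiesz X) (hPerv : IsPervasive X)
    {Y : Type*} [AddCommGroup Y] [Module ℝ Y] [PartialOrder Y] [IsOrderedAddMonoid Y]
    [PosSMulMono ℝ Y]
    (i : X →ₗ[ℝ] Y) (hi : IsDedekindCompletion i)
    (I : Submodule ℝ X) (hI : IsIdeal I) (hDir : IsDirectedSubspace I) :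
    IsLeast {J : Submodule ℝ Y | IsExtensionIdeal i I J} (smallestExtensionIdeal i I) ∧
      IsDedekindCompletion (restrictToExtension i I) ∧
      IsPervasive I := by
  -- `IsPreRiesz` and `IsPervasive` only see covers in the universe of `X`, and `Y` may live
  -- elsewhere; `Z` therefore carries pervasiveness over to `Y` and supplies the cover of `I`.
  obtain ⟨Z, _, _, _, _, _, j, hj⟩ := hPre
  have hjp : IsPervasiveIn j := hPerv.2 Z j hj
  have hip : IsPervasiveIn i := hjp.of_cover hj hi.toIsVectorLatticeCover
  have hjI := isVectorLatticeCover_restrictToExtension hArch hj hjp hI hDir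
  refine ⟨?_, ⟨?_, ?_⟩, hjI.isPreRiesz, ?_⟩
  · rw [smallestExtensionIdeal_eq_idealSpan hi.isBipositive hI hDir]
    exact isLeast_idealSpan hi.isBipositive hI hDir
  · exact isVectorLatticeCover_restrictToExtension hArch hi.toIsVectorLatticeCover hip hI hDir
  · exact isDedekindComplete_smallestExtensionIdeal hi.isBipositive hi.isDedekindComplete hI hDir
  · intro W _ _ _ _ _ k hk
    exact (isPervasiveIn_restrictToExtension hj.isBipositive hjp hI hDir).of_cover hjI hk
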